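/- Let $n\ge 1$, let $\Omega\subset\mathbb{R}^n$ be a bounded Lipschitz domain and write $V:=H^1(\Omega)$. Let $f\in L^2(\Omega)$, let $h\in H^{1/2}(\partial\Omega)$ (the space of traces of functions in $V$), and let $\psi\in V$ satisfy $\psi\le h$ on $\partial\Omega$ in the sense of traces. Put $$K:=\{v\in V : v\ge\psi \text{ a.e. in }\Omega,\ v=h \text{ on }\partial\Omega\},$$ where boundary values are understood in the sense of traces in $L^2(\partial\Omega)$. Let $A\colon V\to V^*$ be an arbitrary map; in particular $A$ may be the operator $A=-\Delta+\sum_{i=1}^n b_i\partial_{x_i}+k\,\mathrm{Id}$ with constants $b_i,k\in\mathbb{R}$, i.e. $$\langle Au,w\rangle_{V^*,V}=\int_\Omega \nabla u\cdot\nabla w+\sum_{i=1}^n b_i\,\partial_{x_i}u\,w+k\,u\,w\qquad(u,w\in V).$$ For $u\in V$ we write $Au\in L^2(\Omega)$ if there is $g\in L^2(\Omega)$ with $\langle Au,\varphi\rangle_{V^*,V}=\int_\Omega g\varphi$ for all $\varphi\in V$ with zero trace on $\partial\Omega$; the function $g$ is then unique and is again denoted by $Au$. We consider the variational inequality $$u\in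 K,\qquad \langle Au-f,u-v\rangle_{V^*,V}\le 0\quad\text{for all }v\in K \tag{VI}$$ and the complementarity system $$Au-f\ge 0,\quad u-\psi\ge 0,\quad (Au-f)(u-\psi)=0\quad\text{a.e. in }\Omega,\qquad u=h\ \text{ on }\partial\Omega. \tag{CS}$$ Then: 1. If $u\in V$ satisfies $Au\in L^2(\Omega)$ and (CS), then $u$ solves (VI). 2. Conversely, if $u$ solves (VI), $u\in C^0(\overline\Omega)$, $Au\in L^2(\Omega)$ and $\psi\in C^0(\overline\Omega)$, then $u$ solves (CS). -/

import Mathlib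

open MeasureTheory Filter Topology Set
open scoped ContDiff InnerProductSpace

noncomputable section

namespace Obstacle

/-- Euclidean space `ℝⁿ`. -/
abbrev Eucl (n : ℕ) : Type := EuclideanSpace ℝ (Fin n)

/-- The standard basis vector `e_i` of `ℝⁿ`. -/
abbrev stdVec {n : ℕ} (i : Fin n) : Eucl n := EuclideanSpace.single i (1 : ℝ)

/-- A bounded Lipschitz domain: a bounded, open, connected, non-empty set which near each of its
boundary points is, in suitable orthonormal coordinates (with vertical direction `e`), the region
lying strictly above the graph of a Lipschitz function. The function `γ` is evaluated only on the
hyperplane orthogonal to `e`. -/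
structure IsBoundedLipschitzDomain {n : ℕ} (Ω : Set (Eucl n)) : Prop where
  isOpen : IsOpen Ω
  isConnected : IsConnected Ω
  isBounded : Bornology.IsBounded Ω
  lipschitz_boundary : ∀ x ∈ frontier Ω, ∃ e : Eucl n, ‖e‖ = 1 ∧
    ∃ (γ : Eucl n → ℝ) (L : NNReal), LipschitzWith L γ ∧
      ∃ r > 0, ∀ y ∈ Metric.ball x r, (y ∈ Ω ↔ γ (y - ⟪e, y⟫_ℝ • e) < ⟪e, y⟫_ℝ)

/-- `φ ∈ C_c^∞(Ω)`. -/
structure IsTestFunction {n : ℕ} (Ω : Set (Eucl n)) (φ : Eucl n → ℝ) : Prop where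
  contDiff : ContDiff ℝ ∞ φ
  hasCompactSupport : HasCompactSupport φ
  tsupport_subset : tsupport φ ⊆ Ω

/-- The Lebesgue measure on `Ω`. -/
abbrev volOn {n : ℕ} (Ω : Set (Eucl n)) : Measure (Eucl n) := volume.restrict Ω

/-- The surface measure on `∂Ω`, i.e. the `(n-1)`-dimensional Hausdorff measure (normalised so that
it is the `(n-1)`-dimensional Lebesgue measure on flat pieces). -/
abbrev surfaceMeasure {n : ℕ} (Ω : Set (Eucl n)) : Measure (Eucl n) :=
  (Measure.euclideanHausdorffMeasure (n - 1)).restrict (frontier Ω)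

/-- `L²(Ω)`. -/
abbrev L2 {n : ℕ} (Ω : Set (Eucl n)) : Type := Lp ℝ 2 (volOn Ω)

/-- `L²(Ω; ℝⁿ)`. -/
abbrev L2Vec {n : ℕ} (Ω : Set (Eucl n)) : Type := Lp (Eucl n) 2 (volOn Ω)

/-- `L²(∂Ω)`. -/
abbrev L2Boundary {n : ℕ} (Ω : Set (Eucl n)) : Type := Lp ℝ 2 (surfaceMeasure Ω)

/-- `G` is the weak gradient of `u` in `Ω`. -/
def IsWeakGradient {n : ℕ} (Ω : Set (Eucl n)) (u : L2 Ω) (G : L2Vec Ω) : Prop :=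
  ∀ φ : Eucl n → ℝ, IsTestFunction Ω φ → ∀ i : Fin n,
    ∫ x in Ω, u x * fderiv ℝ φ x (stdVec i) = -∫ x in Ω, G x i * φ x

theorem IsTestFunction.memLp {n : ℕ} {Ω : Set (Eucl n)} {φ : Eucl n → ℝ}
    (hφ : IsTestFunction Ω φ) : MemLp φ 2 (volOn Ω) :=
  (hφ.contDiff.continuous.memLp_of_hasCompactSupport hφ.hasCompactSupport).restrict Ω

theorem IsTestFunction.memLp_fderiv {n : ℕ} {Ω : Set (Eucl n)} {φ : Eucl n → ℝ}
    (hφ : IsTestFunction Ω φ) (v : Eucl n) : MemLp (fun x => fderiv ℝ φ x v) 2 (volOn Ω) := by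
  have hc : Continuous (fun x => fderiv ℝ φ x v) :=
    (hφ.contDiff.continuous_fderiv (by simp)).clm_apply continuous_const
  have hs : HasCompactSupport (fun x => fderiv ℝ φ x v) :=
    (hφ.hasCompactSupport.fderiv (𝕜 := ℝ)).comp_left (g := fun T : Eucl n →L[ℝ] ℝ => T v) rfl
  exact (hc.memLp_of_hasCompactSupport hs).restrict Ω

theorem L2Vec.memLp_coord {n : ℕ} {Ω : Set (Eucl n)} (G : L2Vec Ω) (i : Fin n) :
    MemLp (fun x => G x i) 2 (volOn Ω) :=
  (EuclideanSpace.proj i : Eucl n →L[ℝ] ℝ).comp_memLp' (Lp.memLp G)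

theorem isWeakGradient_zero {n : ℕ} (Ω : Set (Eucl n)) : IsWeakGradient Ω 0 0 := by
  intro φ _ i
  have h1 : ∫ x in Ω, (0 : L2 Ω) x * fderiv ℝ φ x (stdVec i) = 0 := by
    refine (integral_congr_ae ?_).trans (integral_zero _ _)
    filter_upwards [Lp.coeFn_zero ℝ 2 (volOn Ω)] with x hx
    rw [hx, Pi.zero_apply, zero_mul]
  have h2 : ∫ x in Ω, (0 : L2Vec Ω) x i * φ x = 0 := by
    refine (integral_congr_ae ?_).trans (integral_zero _ _)
    filter_upwards [Lp.coeFn_zero (Eucl n) 2 (volOn Ω)] with x hx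
    rw [hx]
    exact zero_mul _
  rw [h1, h2, neg_zero]

theorem IsWeakGradient.add {n : ℕ} {Ω : Set (Eucl n)} {u v : L2 Ω} {G H : L2Vec Ω}
    (hu : IsWeakGradient Ω u G) (hv : IsWeakGradient Ω v H) :
    IsWeakGradient Ω (u + v) (G + H) := by
  intro φ hφ i
  have e1 : ∫ x in Ω, (u + v) x * fderiv ℝ φ x (stdVec i)
      = (∫ x in Ω, u x * fderiv ℝ φ x (stdVec i)) + ∫ x in Ω, v x * fderiv ℝ φ x (stdVec i) := by
    refine Eq.trans ?_ (integral_add ((Lp.memLp u).integrable_mul (hφ.memLp_fderiv _))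
      ((Lp.memLp v).integrable_mul (hφ.memLp_fderiv _)))
    refine integral_congr_ae ?_
    filter_upwards [Lp.coeFn_add u v] with x hx
    rw [hx]
    exact add_mul _ _ _
  have e2 : ∫ x in Ω, (G + H) x i * φ x
      = (∫ x in Ω, G x i * φ x) + ∫ x in Ω, H x i * φ x := by
    refine Eq.trans ?_ (integral_add ((L2Vec.memLp_coord G i).integrable_mul hφ.memLp)
      ((L2Vec.memLp_coord H i).integrable_mul hφ.memLp))
    refine integral_congr_ae ?_
    filter_upwards [Lp.coeFn_add G H] with x hx
    rw [hx]
    exact add_mul _ _ _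
  rw [e1, e2, hu φ hφ i, hv φ hφ i, neg_add]

theorem IsWeakGradient.smul {n : ℕ} {Ω : Set (Eucl n)} {u : L2 Ω} {G : L2Vec Ω} (c : ℝ)
    (hu : IsWeakGradient Ω u G) : IsWeakGradient Ω (c • u) (c • G) := by
  intro φ hφ i
  have e1 : ∫ x in Ω, (c • u) x * fderiv ℝ φ x (stdVec i)
      = c * ∫ x in Ω, u x * fderiv ℝ φ x (stdVec i) := by
    rw [← integral_const_mul]
    refine integral_congr_ae ?_
    filter_upwards [Lp.coeFn_smul c u] with x hx
    simp [hx, mul_assoc]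
  have e2 : ∫ x in Ω, (c • G) x i * φ x = c * ∫ x in Ω, G x i * φ x := by
    rw [← integral_const_mul]
    refine integral_congr_ae ?_
    filter_upwards [Lp.coeFn_smul c G] with x hx
    simp [hx, mul_assoc]
  rw [e1, e2, hu φ hφ i, mul_neg]

/-- The Sobolev space `H¹(Ω)`, realised as the space of pairs `(u, ∇u)` of a function `u ∈ L²(Ω)`
and its (unique) weak gradient `∇u ∈ L²(Ω; ℝⁿ)`. The norm inherited from the Hilbert sum
`L²(Ω) ⊕ L²(Ω; ℝⁿ)` is `‖u‖² = ∫ u² + ∫ |∇u|²`. -/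
def H1 {n : ℕ} (Ω : Set (Eucl n)) : Submodule ℝ (WithLp 2 (L2 Ω × L2Vec Ω)) where
  carrier := {p | IsWeakGradient Ω p.fst p.snd}
  zero_mem' := isWeakGradient_zero Ω
  add_mem' := fun hp hq => IsWeakGradient.add hp hq
  smul_mem' := fun c _ hp => IsWeakGradient.smul c hp

/-- The embedding `H¹(Ω) → L²(Ω)`. -/
def toL2 {n : ℕ} {Ω : Set (Eucl n)} : H1 Ω →L[ℝ] L2 Ω :=
  (WithLp.fstL 2 ℝ (L2 Ω) (L2Vec Ω)).comp (H1 Ω).subtypeL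

/-- The weak gradient `H¹(Ω) → L²(Ω; ℝⁿ)`. -/
def grad {n : ℕ} {Ω : Set (Eucl n)} : H1 Ω →L[ℝ] L2Vec Ω :=
  (WithLp.sndL 2 ℝ (L2 Ω) (L2Vec Ω)).comp (H1 Ω).subtypeL

/-- The weak partial derivative `∂_i : H¹(Ω) → L²(Ω)`. -/
def partialDeriv {n : ℕ} {Ω : Set (Eucl n)} (i : Fin n) : H1 Ω →L[ℝ] L2 Ω :=
  ((EuclideanSpace.proj i : Eucl n →L[ℝ] ℝ).compLpL 2 (volOn Ω)).comp grad

/-- The topological dual `H¹(Ω)*`. -/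
abbrev H1Dual {n : ℕ} (Ω : Set (Eucl n)) : Type := StrongDual ℝ (H1 Ω)

/-- The embedding `L²(Ω) → H¹(Ω)*`, sending `g` to `v ↦ ∫_Ω g v`. -/
def L2toDual {n : ℕ} {Ω : Set (Eucl n)} (g : L2 Ω) : H1Dual Ω :=
  (innerSL ℝ g).comp toL2

theorem L2toDual_apply {n : ℕ} {Ω : Set (Eucl n)} (g : L2 Ω) (v : H1 Ω) :
    L2toDual g v = ∫ x in Ω, g x * toL2 v x := by
  change ⟪g, toL2 v⟫_ℝ = _
  rw [MeasureTheory.L2.inner_def]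
  refine integral_congr_ae (Eventually.of_forall fun x => ?_)
  simp [mul_comm]

/-- `u ∈ H¹(Ω)` has the boundary trace `h ∈ L²(∂Ω)`: there are restrictions `w k ∈ H¹(Ω)` of
functions `φ k ∈ C^∞(ℝⁿ)` with `w k → u` in `H¹(Ω)` and `φ k → h` in `L²(∂Ω)`. -/
def HasTrace {n : ℕ} {Ω : Set (Eucl n)} (u : H1 Ω) (h : L2Boundary Ω) : Prop :=
  ∃ (φ : ℕ → Eucl n → ℝ) (w : ℕ → H1 Ω),
    (∀ k, ContDiff ℝ ∞ (φ k)) ∧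
    (∀ k, toL2 (w k) =ᵐ[volOn Ω] φ k) ∧
    Tendsto w atTop (𝓝 u) ∧
    Tendsto (fun k => eLpNorm (fun x => φ k x - h x) 2 (surfaceMeasure Ω)) atTop (𝓝 0)

/-- `H^{1/2}(∂Ω)`, the space of the boundary traces of functions in `H¹(Ω)`. -/
def HHalf {n : ℕ} (Ω : Set (Eucl n)) : Set (L2Boundary Ω) := {h | ∃ w : H1 Ω, HasTrace w h}

/-- `ψ ≤ h` on `∂Ω`, in the sense of traces. -/
def LeOnBoundary {n : ℕ} {Ω : Set (Eucl n)} (ψ : H1 Ω) (h : L2Boundary Ω) : Prop :=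
  ∃ t : L2Boundary Ω, HasTrace ψ t ∧ ∀ᵐ x ∂(surfaceMeasure Ω), t x ≤ h x

/-- The constraint set `K = {u ∈ H¹(Ω) : u ≥ ψ in Ω, u = h on ∂Ω}`. -/
def constraintSet {n : ℕ} {Ω : Set (Eucl n)} (ψ : H1 Ω) (h : L2Boundary Ω) : Set (H1 Ω) :=
  {u | (∀ᵐ x ∂(volOn Ω), toL2 ψ x ≤ toL2 u x) ∧ HasTrace u h}

/-- `u` solves the variational inequality: `u ∈ K` and `⟨Au - f, u - v⟩ ≤ 0` for all `v ∈ K`. -/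
def SolvesVI {n : ℕ} {Ω : Set (Eucl n)} (A : H1 Ω → H1Dual Ω) (f : L2 Ω) (ψ : H1 Ω)
    (h : L2Boundary Ω) (u : H1 Ω) : Prop :=
  u ∈ constraintSet ψ h ∧ ∀ v ∈ constraintSet ψ h, (A u - L2toDual f) (u - v) ≤ 0

/-- `F = g` for a functional `F ∈ H¹(Ω)*` and a function `g ∈ L²(Ω)`: one has `⟨F, φ⟩ = ∫_Ω g φ` for
all `φ ∈ H¹_0(Ω)`, i.e. for all `φ ∈ H¹(Ω)` with zero trace. Functions `φ` with non-zero trace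
are not used: for `F = -Δu`, testing with them would also say that the normal derivative of `u`
vanishes on `∂Ω`. -/
def IsRepresentedBy {n : ℕ} {Ω : Set (Eucl n)} (F : H1Dual Ω) (g : L2 Ω) : Prop :=
  ∀ φ : H1 Ω, HasTrace φ 0 → F φ = L2toDual g φ

/-- `F ∈ L²(Ω)` for a functional `F ∈ H¹(Ω)*`. -/
def IsInL2 {n : ℕ} {Ω : Set (Eucl n)} (F : H1Dual Ω) : Prop :=
  ∃ g : L2 Ω, IsRepresentedBy F g

/-- `u` solves the complementarity system: `Au` is a function `g ∈ L²(Ω)` with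
`0 ≤ g - f`, `u - ψ ≥ 0` and `(g - f)(u - ψ) = 0` a.e. in `Ω`, and `u = h` on `∂Ω`. -/
def SolvesCS {n : ℕ} {Ω : Set (Eucl n)} (A : H1 Ω → H1Dual Ω) (f : L2 Ω) (ψ : H1 Ω)
    (h : L2Boundary Ω) (u : H1 Ω) : Prop :=
  (∃ g : L2 Ω, IsRepresentedBy (A u) g ∧
    ∀ᵐ x ∂(volOn Ω), 0 ≤ g x - f x ∧ 0 ≤ toL2 u x - toL2 ψ x ∧
      (g x - f x) * (toL2 u x - toL2 ψ x) = 0) ∧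
  HasTrace u h

/-- `u ∈ C⁰(Ω̄)`: `u` has a representative that is continuous on the closure of `Ω`. -/
def IsContinuousOnClosure {n : ℕ} {Ω : Set (Eucl n)} (u : H1 Ω) : Prop :=
  ∃ w : Eucl n → ℝ, ContinuousOn w (closure Ω) ∧ toL2 u =ᵐ[volOn Ω] w

/-- The operator `A = -Δ + ∑ b_i ∂_i + k Id : H¹(Ω) → H¹(Ω)*`. -/
def ellipticOperator {n : ℕ} {Ω : Set (Eucl n)} (b : Fin n → ℝ) (k : ℝ) (u : H1 Ω) : H1Dual Ω :=
  (innerSL ℝ (grad u)).comp grad + ∑ i, b i • L2toDual (partialDeriv i u) + k • L2toDual (toL2 u)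

/-- `⟨Au, w⟩ = ∫_Ω ∇u · ∇w + ∑ b_i ∂_i u w + k u w`. -/
theorem ellipticOperator_apply {n : ℕ} {Ω : Set (Eucl n)} (b : Fin n → ℝ) (k : ℝ) (u w : H1 Ω) :
    ellipticOperator b k u w =
      ∫ x in Ω, (⟪grad u x, grad w x⟫_ℝ + ∑ i, b i * grad u x i * toL2 w x
        + k * toL2 u x * toL2 w x) := by
  have hp : ∀ i, MemLp (fun x => grad u x i) 2 (volOn Ω) := fun i => L2Vec.memLp_coord _ i
  have hw : MemLp (fun x => toL2 w x) 2 (volOn Ω) := Lp.memLp _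
  have hu : MemLp (fun x => toL2 u x) 2 (volOn Ω) := Lp.memLp _
  have i1 : Integrable (fun x => ⟪grad u x, grad w x⟫_ℝ) (volOn Ω) :=
    MeasureTheory.L2.integrable_inner _ _
  have i2 : ∀ i, Integrable (fun x => b i * grad u x i * toL2 w x) (volOn Ω) := fun i => by
    simpa [mul_assoc] using ((hp i).integrable_mul hw).const_mul (b i)
  have i3 : Integrable (fun x => k * toL2 u x * toL2 w x) (volOn Ω) := by
    simpa [mul_assoc] using (hu.integrable_mul hw).const_mul k
  have i23 := integrable_finsetSum Finset.univ (fun i _ => i2 i)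
  have i12 : Integrable (fun x => ⟪grad u x, grad w x⟫_ℝ + ∑ i, b i * grad u x i * toL2 w x)
      (volOn Ω) := i1.add i23
  rw [integral_add i12 i3, integral_add i1 i23,
    integral_finsetSum _ (fun i _ => i2 i)]
  have e1 : ((innerSL ℝ (grad u)).comp (grad (Ω := Ω))) w = ∫ x in Ω, ⟪grad u x, grad w x⟫_ℝ :=
    MeasureTheory.L2.inner_def _ _
  have e2 : ∀ i, L2toDual (partialDeriv i u) w = ∫ x in Ω, grad u x i * toL2 w x := fun i => by
    rw [L2toDual_apply]
    refine integral_congr_ae ?_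
    filter_upwards [(EuclideanSpace.proj i : Eucl n →L[ℝ] ℝ).coeFn_compLpL
      (p := 2) (μ := volOn Ω) (grad u)] with x hx
    exact congrArg (· * toL2 w x) hx
  simp only [ellipticOperator, add_apply, sum_apply,
    smul_apply, e1, e2, L2toDual_apply, smul_eq_mul, mul_assoc,
    integral_const_mul]

end Obstacle

end

open Obstacle

namespace Obstacle

open Metric

variable {n : ℕ} {Ω : Set (Eucl n)}

/-! Let `g` represent `Au`. From (CS) to (VI): for `v ∈ K` the difference `u - v` has zero trace, so
the pairing is `∫ (g - f)(u - v)`, and `(g - f)(u - v) = (g - f)(u - ψ) - (g - f)(v - ψ)`, where the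
first term vanishes and the second product is non-negative.

Conversely, (VI) is tested with `u + φ`, `φ` a test function with `u + φ ≥ ψ`; this gives `∫ (g - f)
φ ≥ 0` (`SolvesVI.integral_nonneg_of_le_add`). Every `φ ≥ 0` is admissible, hence `g ≥ f`
(`ae_nonneg_of_forall_testFunction`). Continuity makes the non-contact set `{u > ψ}` open and bounds
`u - ψ` below on compact subsets, so there small multiples of any `φ`, of both signs, are admissible
(`IsTestFunction.exists_pos_mul_abs_le`), and `g = f`. -/

theorem HasTrace.add {u v : H1 Ω} {h t : L2Boundary Ω} (hu : HasTrace u h) (hv : HasTrace v t) :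
    HasTrace (u + v) (h + t) := by
  obtain ⟨φ, w, hφ, hw, hwu, hφh⟩ := hu
  obtain ⟨η, z, hη, hz, hzv, hηt⟩ := hv
  refine ⟨fun k => φ k + η k, fun k => w k + z k, fun k => (hφ k).add (hη k), fun k => ?_,
    hwu.add hzv, ?_⟩
  · rw [map_add]
    filter_upwards [Lp.coeFn_add (toL2 (w k)) (toL2 (z k)), hw k, hz k] with x h1 h2 h3
    rw [h1, Pi.add_apply, Pi.add_apply, h2, h3]
  · refine tendsto_of_tendsto_of_tendsto_of_le_of_le tendsto_const_nhds
      (by simpa using hφh.add hηt) (fun _ => zero_le) fun k => ?_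
    refine le_trans (le_of_eq ?_) (eLpNorm_add_le
      ((hφ k).continuous.aestronglyMeasurable.sub (Lp.aestronglyMeasurable h))
      ((hη k).continuous.aestronglyMeasurable.sub (Lp.aestronglyMeasurable t)) (by norm_num))
    refine eLpNorm_congr_ae ?_
    filter_upwards [Lp.coeFn_add h t] with x hx
    simp only [hx, Pi.add_apply]
    ring

theorem HasTrace.neg {u : H1 Ω} {h : L2Boundary Ω} (hu : HasTrace u h) : HasTrace (-u) (-h) := by
  obtain ⟨φ, w, hφ, hw, hwu, hφh⟩ := hu
  refine ⟨fun k => -φ k, fun k => -w k, fun k => (hφ k).neg, fun k => ?_, hwu.neg, ?_⟩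
  · rw [map_neg]
    filter_upwards [Lp.coeFn_neg (toL2 (w k)), hw k] with x h1 h2
    rw [h1, Pi.neg_apply, Pi.neg_apply, h2]
  · refine hφh.congr fun k => ?_
    rw [← eLpNorm_neg]
    refine eLpNorm_congr_ae ?_
    filter_upwards [Lp.coeFn_neg h] with x hx
    simp only [hx, Pi.neg_apply]
    ring

theorem HasTrace.sub {u v : H1 Ω} {h t : L2Boundary Ω} (hu : HasTrace u h) (hv : HasTrace v t) :
    HasTrace (u - v) (h - t) := by
  simpa only [sub_eq_add_neg] using hu.add hv.neg

theorem toL2_add_ae (u v : H1 Ω) :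
    ∀ᵐ x ∂(volOn Ω), toL2 (u + v) x = toL2 u x + toL2 v x := by
  rw [map_add]
  exact Lp.coeFn_add _ _

theorem toL2_sub_ae (u v : H1 Ω) :
    ∀ᵐ x ∂(volOn Ω), toL2 (u - v) x = toL2 u x - toL2 v x := by
  rw [map_sub]
  exact Lp.coeFn_sub _ _

theorem L2toDual_sub_apply (f g : L2 Ω) (w : H1 Ω) :
    L2toDual g w - L2toDual f w = ∫ x in Ω, (g x - f x) * toL2 w x := by
  rw [L2toDual_apply, L2toDual_apply]
  simp only [sub_mul]
  exact (integral_sub ((Lp.memLp g).integrable_mul (Lp.memLp (toL2 w)))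
    ((Lp.memLp f).integrable_mul (Lp.memLp (toL2 w)))).symm

/-! ### Test functions as elements of `H¹(Ω)` with zero trace -/

theorem IsTestFunction.smul {φ : Eucl n → ℝ} (hφ : IsTestFunction Ω φ) (c : ℝ) :
    IsTestFunction Ω (c • φ) where
  contDiff := hφ.contDiff.const_smul c
  hasCompactSupport := hφ.hasCompactSupport.smul_left (f := fun _ => c)
  tsupport_subset := (tsupport_smul_subset_right (fun _ => c) φ).trans hφ.tsupport_subset

theorem IsTestFunction.mono {U : Set (Eucl n)} {φ : Eucl n → ℝ} (hφ : IsTestFunction U φ)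
    (hU : U ⊆ Ω) : IsTestFunction Ω φ :=
  ⟨hφ.contDiff, hφ.hasCompactSupport, hφ.tsupport_subset.trans hU⟩

theorem IsTestFunction.eq_zero {φ : Eucl n → ℝ} (hφ : IsTestFunction Ω φ) {x : Eucl n}
    (hx : x ∉ Ω) : φ x = 0 :=
  image_eq_zero_of_notMem_tsupport fun h => hx (hφ.tsupport_subset h)

theorem IsTestFunction.memLp_gradient {φ : Eucl n → ℝ} (hφ : IsTestFunction Ω φ) :
    MemLp (gradient φ) 2 (volOn Ω) := by
  have hc : Continuous (gradient φ) :=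
    (InnerProductSpace.toDual ℝ (Eucl n)).symm.continuous.comp
      (hφ.contDiff.continuous_fderiv (by simp))
  have hs : HasCompactSupport (gradient φ) :=
    (hφ.hasCompactSupport.fderiv (𝕜 := ℝ)).comp_left (map_zero _)
  exact (hc.memLp_of_hasCompactSupport hs).restrict Ω

theorem gradient_apply (φ : Eucl n → ℝ) (x : Eucl n) (i : Fin n) :
    gradient φ x i = fderiv ℝ φ x (stdVec i) := by
  have h := InnerProductSpace.toDual_symm_apply (𝕜 := ℝ) (x := stdVec i) (y := fderiv ℝ φ x)
  rw [← h, EuclideanSpace.inner_single_right]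
  simp [gradient]

/-- Both integrands vanish off `Ω`, so the integrals extend to all of `ℝⁿ`, where integration by
parts has no boundary term. -/
theorem IsTestFunction.isWeakGradient {φ : Eucl n → ℝ} (hφ : IsTestFunction Ω φ) :
    IsWeakGradient Ω (hφ.memLp.toLp φ) (hφ.memLp_gradient.toLp (gradient φ)) := by
  intro η hη i
  have e1 : ∫ x in Ω, (hφ.memLp.toLp φ) x * fderiv ℝ η x (stdVec i)
      = ∫ x, φ x * fderiv ℝ η x (stdVec i) := by
    refine Eq.trans (integral_congr_ae ?_) (setIntegral_eq_integral_of_forall_compl_eq_zero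
      fun x hx => by rw [hφ.eq_zero hx, zero_mul])
    filter_upwards [hφ.memLp.coeFn_toLp] with x hx
    rw [hx]
  have e2 : ∫ x in Ω, (hφ.memLp_gradient.toLp (gradient φ)) x i * η x
      = ∫ x, fderiv ℝ φ x (stdVec i) * η x := by
    refine Eq.trans (integral_congr_ae ?_) (setIntegral_eq_integral_of_forall_compl_eq_zero
      fun x hx => by rw [hη.eq_zero hx, mul_zero])
    filter_upwards [hφ.memLp_gradient.coeFn_toLp] with x hx
    rw [hx, gradient_apply]
  have hφ' := hφ.mono (subset_univ Ω)
  have hη' := hη.mono (subset_univ Ω)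
  rw [e1, e2]
  refine integral_mul_fderiv_eq_neg_fderiv_mul_of_integrable ?_ ?_ ?_
    (fun x _ => hφ.contDiff.differentiable (by simp) x)
    (fun x _ => hη.contDiff.differentiable (by simp) x)
  · exact integrableOn_univ.1 ((hφ'.memLp_fderiv (stdVec i)).integrable_mul hη'.memLp)
  · exact integrableOn_univ.1 (hφ'.memLp.integrable_mul (hη'.memLp_fderiv (stdVec i)))
  · exact integrableOn_univ.1 (hφ'.memLp.integrable_mul hη'.memLp)

/-- A test function as an element of `H¹(Ω)`. -/
noncomputable def IsTestFunction.toH1 {φ : Eucl n → ℝ} (hφ : IsTestFunction Ω φ) : H1 Ω :=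
  ⟨WithLp.toLp 2 (hφ.memLp.toLp φ, hφ.memLp_gradient.toLp (gradient φ)), hφ.isWeakGradient⟩

theorem IsTestFunction.toL2_toH1 {φ : Eucl n → ℝ} (hφ : IsTestFunction Ω φ) :
    toL2 hφ.toH1 =ᵐ[volOn Ω] φ :=
  hφ.memLp.coeFn_toLp

theorem IsTestFunction.hasTrace_toH1 (hΩ : IsOpen Ω) {φ : Eucl n → ℝ}
    (hφ : IsTestFunction Ω φ) : HasTrace hφ.toH1 0 := by
  refine ⟨fun _ => φ, fun _ => hφ.toH1, fun _ => hφ.contDiff, fun _ => hφ.toL2_toH1,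
    tendsto_const_nhds, ?_⟩
  have h0 : (fun x => φ x - (0 : L2Boundary Ω) x) =ᵐ[surfaceMeasure Ω] 0 := by
    filter_upwards [Lp.coeFn_zero ℝ 2 (surfaceMeasure Ω),
      ae_restrict_mem isClosed_frontier.measurableSet] with x hx hxf
    have hxΩ : x ∉ Ω := fun hx' => by
      rw [hΩ.frontier_eq] at hxf
      exact hxf.2 hx'
    rw [hx, hφ.eq_zero hxΩ, Pi.zero_apply, sub_zero]
  simp only [eLpNorm_congr_ae h0, eLpNorm_zero]
  exact tendsto_const_nhds

/-! ### Sign of a function from its integrals against test functions -/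

/-- The indicator of `s` is the pointwise limit of smooth cutoffs supported in shrinking thickenings
of `s`; dominated convergence with bound `‖k‖` passes the sign to the limit. -/
theorem setIntegral_nonneg_of_isCompact (hΩ : IsOpen Ω) {k : Eucl n → ℝ}
    (hk : IntegrableOn k Ω)
    (h : ∀ φ, IsTestFunction Ω φ → (∀ x, 0 ≤ φ x) → 0 ≤ ∫ x in Ω, k x * φ x)
    {s : Set (Eucl n)} (hs : IsCompact s) (hsΩ : s ⊆ Ω) : 0 ≤ ∫ x in s, k x := by
  obtain ⟨δ, hδ, hδΩ⟩ := hs.exists_cthickening_subset_open hΩ hsΩ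
  obtain ⟨u, -, hu, u_lim⟩ := exists_seq_strictAnti_tendsto' hδ
  have hsub : ∀ m, closure (thickening (u m) s) ⊆ cthickening δ s := fun m =>
    closure_minimal (thickening_subset_cthickening_of_le (hu m).2.le s) isClosed_cthickening
  have hex : ∀ m, ∃ φ : Eucl n → ℝ, Function.support φ = thickening (u m) s ∧
      IsTestFunction Ω φ ∧ range φ ⊆ Icc 0 1 ∧ ∀ x ∈ s, φ x = 1 := by
    intro m
    rcases exists_contMDiff_support_eq_eq_one_iff (modelWithCornersSelf ℝ (Eucl n))
      isOpen_thickening hs.isClosed (self_subset_thickening (hu m).1 s) with ⟨φ, h1, h2, h3, h4⟩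
    refine ⟨φ, h3, ⟨h1.contDiff, ?_, ?_⟩, h2, fun x hx => (h4 x).1 hx⟩
    · refine hs.cthickening.of_isClosed_subset (isClosed_tsupport φ) (?_ : _ ⊆ cthickening δ s)
      rw [tsupport, h3]
      exact hsub m
    · rw [tsupport, h3]
      exact (hsub m).trans hδΩ
  choose φ φ_supp φ_test φ_range hφ using hex
  have hL : Tendsto (fun m => ∫ x in Ω, k x * φ m x) atTop (𝓝 (∫ x in Ω, s.indicator k x)) := by
    refine tendsto_integral_of_dominated_convergence (fun x => ‖k x‖)
      (fun m => hk.aestronglyMeasurable.mul (φ_test m).contDiff.continuous.aestronglyMeasurable)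
      hk.norm (fun m => Eventually.of_forall fun x => ?_) (Eventually.of_forall fun x => ?_)
    · have hr := φ_range m (mem_range_self x)
      rw [norm_mul, Real.norm_of_nonneg hr.1]
      exact mul_le_of_le_one_right (norm_nonneg _) hr.2
    · by_cases hxs : x ∈ s
      · simp only [hφ _ x hxs, mul_one, indicator_of_mem hxs]
        exact tendsto_const_nhds
      · rw [indicator_of_notMem hxs]
        refine tendsto_const_nhds.congr' ?_
        obtain ⟨ε, εpos, hε⟩ : ∃ ε, 0 < ε ∧ x ∉ thickening ε s := by
          rw [← hs.isClosed.closure_eq, closure_eq_iInter_thickening s] at hxs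
          simpa using hxs
        filter_upwards [(tendsto_order.1 u_lim).2 _ εpos] with m hm
        have : φ m x = 0 := by
          rw [← Function.notMem_support, φ_supp]
          exact fun hx => hε (thickening_mono hm.le s hx)
        rw [this, mul_zero]
  have hlim := ge_of_tendsto' hL fun m =>
    h _ (φ_test m) fun x => (φ_range m (mem_range_self x)).1
  rwa [setIntegral_indicator hs.measurableSet, inter_eq_right.2 hsΩ] at hlim

/-- A measurable function which is non-negative as a distribution is non-negative a.e. -/
theorem ae_nonneg_of_forall_testFunction (hΩ : IsOpen Ω) {k : Eucl n → ℝ} (hkm : Measurable k)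
    (hk : IntegrableOn k Ω)
    (h : ∀ φ, IsTestFunction Ω φ → (∀ x, 0 ≤ φ x) → 0 ≤ ∫ x in Ω, k x * φ x) :
    ∀ᵐ x ∂(volOn Ω), 0 ≤ k x := by
  rw [ae_restrict_iff' hΩ.measurableSet, ae_iff]
  by_contra hne
  have hset : {x | ¬(x ∈ Ω → 0 ≤ k x)} = Ω ∩ k ⁻¹' Iio 0 := by
    ext x
    simp
  rw [hset] at hne
  -- Inner regularity: a non-null negativity set contains a compact set of positive measure.
  obtain ⟨s, hsub, hs, hpos⟩ := (hΩ.measurableSet.inter (hkm measurableSet_Iio)).exists_lt_isCompact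
    (pos_iff_ne_zero.2 hne)
  have hint : IntegrableOn k s := hk.mono_set fun x hx => (hsub hx).1
  have hneg : ∀ x ∈ s, k x < 0 := fun x hx => (hsub hx).2
  have h1 := setIntegral_nonneg_of_isCompact hΩ hk h hs fun x hx => (hsub hx).1
  have h2 : 0 < ∫ x in s, -k x := by
    refine (setIntegral_pos_iff_support_of_nonneg_ae
      ((ae_restrict_mem hs.measurableSet).mono fun x hx => (neg_pos.2 (hneg x hx)).le)
      hint.neg).2 ?_
    rwa [inter_eq_right.2 fun x hx => ?_]
    exact neg_ne_zero.2 (hneg x hx).ne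
  rw [integral_neg] at h2
  linarith

theorem IsTestFunction.exists_pos_mul_abs_le {U : Set (Eucl n)} {φ w : Eucl n → ℝ}
    (hφ : IsTestFunction U φ) (hw : ContinuousOn w U) (hpos : ∀ x ∈ U, 0 < w x) :
    ∃ ε > 0, ∀ x ∈ tsupport φ, ε * |φ x| ≤ w x := by
  obtain ⟨m, hm, hmw⟩ := hφ.hasCompactSupport.isCompact.exists_forall_le'
    (hw.mono hφ.tsupport_subset) fun x hx => hpos x (hφ.tsupport_subset hx)
  obtain ⟨C, hC⟩ := hφ.hasCompactSupport.exists_bound_of_continuous hφ.contDiff.continuous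
  have hC0 : 0 ≤ C := (norm_nonneg _).trans (hC 0)
  -- The `+ 1` keeps the denominator positive when `C = 0`.
  refine ⟨m / (C + 1), by positivity, fun x hx => le_trans ?_ (hmw x hx)⟩
  rw [div_mul_eq_mul_div, div_le_iff₀ (by positivity)]
  have := hC x
  rw [Real.norm_eq_abs] at this
  gcongr
  linarith

/-! ### The two implications -/

variable {A : H1 Ω → H1Dual Ω} {f g : L2 Ω} {ψ u : H1 Ω} {h : L2Boundary Ω}

theorem SolvesCS.solvesVI (hu : SolvesCS A f ψ h u) : SolvesVI A f ψ h u := by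
  obtain ⟨⟨g, hg, hae⟩, hut⟩ := hu
  refine ⟨⟨hae.mono fun x hx => sub_nonneg.1 hx.2.1, hut⟩, fun v hv => ?_⟩
  have htr : HasTrace (u - v) 0 := by simpa using hut.sub hv.2
  rw [sub_apply, hg _ htr, L2toDual_sub_apply]
  refine integral_nonpos_of_ae ?_
  filter_upwards [hae, hv.1, toL2_sub_ae u v] with x hx hvx hsub
  rw [hsub, Pi.zero_apply]
  nlinarith [mul_nonneg hx.1 (sub_nonneg.2 hvx), hx.2.2]

theorem SolvesVI.integral_nonneg_of_le_add (hΩ : IsOpen Ω) (hu : SolvesVI A f ψ h u)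
    (hg : IsRepresentedBy (A u) g) {φ : Eucl n → ℝ} (hφ : IsTestFunction Ω φ)
    (hle : ∀ᵐ x ∂(volOn Ω), toL2 ψ x ≤ toL2 u x + φ x) :
    0 ≤ ∫ x in Ω, (g x - f x) * φ x := by
  have htr := hφ.hasTrace_toH1 hΩ
  have hmem : u + hφ.toH1 ∈ constraintSet ψ h := by
    refine ⟨?_, by simpa using hu.1.2.add htr⟩
    filter_upwards [hle, toL2_add_ae u hφ.toH1, hφ.toL2_toH1] with x h1 h2 h3
    rwa [h2, h3]
  have hvi := hu.2 _ hmem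
  rw [sub_add_cancel_left, map_neg, sub_apply, hg _ htr, L2toDual_sub_apply] at hvi
  refine (neg_nonpos.1 hvi).trans_eq (integral_congr_ae ?_)
  filter_upwards [hφ.toL2_toH1] with x hx
  rw [hx]

theorem SolvesVI.solvesCS (hΩ : IsBoundedLipschitzDomain Ω) (hu : SolvesVI A f ψ h u)
    (huc : IsContinuousOnClosure u) (hA : IsInL2 (A u)) (hψc : IsContinuousOnClosure ψ) :
    SolvesCS A f ψ h u := by
  obtain ⟨g, hg⟩ := hA
  obtain ⟨w, hw, huw⟩ := huc
  obtain ⟨z, hz, hψz⟩ := hψc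
  -- Boundedness of `Ω` gives `L² ⊆ L¹`, hence integrability of `g - f`.
  have : IsFiniteMeasure (volOn Ω) := ⟨by
    rw [Measure.restrict_apply_univ]
    exact hΩ.isBounded.measure_lt_top⟩
  have hint : IntegrableOn (fun x => g x - f x) Ω :=
    ((Lp.memLp g).integrable (by norm_num)).sub ((Lp.memLp f).integrable (by norm_num))
  have hnonneg : ∀ᵐ x ∂(volOn Ω), 0 ≤ g x - f x := by
    refine ae_nonneg_of_forall_testFunction hΩ.isOpen
      ((Lp.stronglyMeasurable g).measurable.sub (Lp.stronglyMeasurable f).measurable) hint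
      fun φ hφ hφ0 => hu.integral_nonneg_of_le_add hΩ.isOpen hg hφ ?_
    filter_upwards [hu.1.1] with x hx
    linarith [hφ0 x]
  have hcont : ContinuousOn (fun x => w x - z x) Ω := (hw.sub hz).mono subset_closure
  set U : Set (Eucl n) := Ω ∩ (fun x => w x - z x) ⁻¹' Ioi 0
  have hU : IsOpen U := hcont.isOpen_inter_preimage hΩ.isOpen isOpen_Ioi
  have hUΩ : U ⊆ Ω := inter_subset_left
  have hzero : ∀ᵐ x, x ∈ U → g x - f x = 0 := by
    refine hU.ae_eq_zero_of_integral_contDiff_smul_eq_zero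
      (hint.mono_set hUΩ).locallyIntegrableOn fun φ h1 h2 h3 => ?_
    have hφU : IsTestFunction U φ := ⟨h1, h2, h3⟩
    have hφ := hφU.mono hUΩ
    obtain ⟨ε, hε, hle⟩ := hφU.exists_pos_mul_abs_le (hcont.mono hUΩ) fun x hx => hx.2
    -- On `tsupport φ` the gap `w - z` absorbs `c * φ`; elsewhere the perturbation is zero. Taking
    -- `c = ε` and `c = -ε` then forces the integral to vanish.
    have key : ∀ c : ℝ, |c| ≤ ε → 0 ≤ c * ∫ x in Ω, (g x - f x) * φ x := by
      intro c hc
      have := hu.integral_nonneg_of_le_add hΩ.isOpen hg (hφ.smul c) (by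
        filter_upwards [hu.1.1, huw, hψz] with x hx hxu hxψ
        by_cases hxs : x ∈ tsupport φ
        · have hb := hle x hxs
          have : |c * φ x| ≤ ε * |φ x| := by
            rw [abs_mul]
            gcongr
          rw [hxu, hxψ, Pi.smul_apply, smul_eq_mul]
          linarith [neg_abs_le (c * φ x)]
        · simpa [image_eq_zero_of_notMem_tsupport hxs] using hx)
      rw [← integral_const_mul]
      refine this.trans_eq (integral_congr_ae (Eventually.of_forall fun x => ?_))
      simp only [Pi.smul_apply, smul_eq_mul]
      ring
    have hp := nonneg_of_mul_nonneg_right (key ε (abs_of_pos hε).le) hε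
    have hn := key (-ε) (by rw [abs_neg, abs_of_pos hε])
    have hn' : ∫ x in Ω, (g x - f x) * φ x ≤ 0 := by
      rw [neg_mul, neg_nonneg] at hn
      exact nonpos_of_mul_nonpos_right hn hε
    rw [← setIntegral_eq_integral_of_forall_compl_eq_zero (s := Ω)
      fun x hx => by rw [hφ.eq_zero hx, zero_smul]]
    simpa only [smul_eq_mul, mul_comm] using le_antisymm hn' hp
  refine ⟨⟨g, hg, ?_⟩, hu.1.2⟩
  filter_upwards [hnonneg, hu.1.1, huw, hψz, ae_restrict_of_ae hzero,
    ae_restrict_mem hΩ.isOpen.measurableSet] with x h1 h2 h3 h4 h5 h6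
  refine ⟨h1, sub_nonneg.2 h2, ?_⟩
  rcases h2.eq_or_lt with he | hlt
  · rw [he, sub_self, mul_zero]
  · rw [h5 ⟨h6, ?_⟩, zero_mul]
    rw [h3, h4] at hlt
    exact sub_pos.2 hlt

end Obstacle


theorem mainTheorem7 {n : ℕ} (hn : 1 ≤ n) (Ω : Set (Eucl n)) (hΩ : IsBoundedLipschitzDomain Ω)
    (f : L2 Ω) (ψ : H1 Ω) (h : L2Boundary Ω) (hh : h ∈ HHalf Ω) (hψ : LeOnBoundary ψ h) :
    -- an arbitrary operator `A`
    (∀ (A : H1 Ω → H1Dual Ω) (u : H1 Ω),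
      (IsInL2 (A u) → SolvesCS A f ψ h u → SolvesVI A f ψ h u) ∧
      (SolvesVI A f ψ h u → IsContinuousOnClosure u → IsInL2 (A u) → IsContinuousOnClosure ψ →
        SolvesCS A f ψ h u)) ∧
    -- in particular, the operator `A = -Δ + ∑ b_i ∂_i + k Id`
    (∀ (b : Fin n → ℝ) (k : ℝ) (u : H1 Ω),
      (IsInL2 (ellipticOperator b k u) →
        SolvesCS (ellipticOperator b k) f ψ h u → SolvesVI (ellipticOperator b k) f ψ h u) ∧
      (SolvesVI (ellipticOperator b k) f ψ h u → IsContinuousOnClosure u →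
        IsInL2 (ellipticOperator b k u) → IsContinuousOnClosure ψ →
        SolvesCS (ellipticOperator b k) f ψ h u)) := by
  have key : ∀ (A : H1 Ω → H1Dual Ω) (u : H1 Ω),
      (IsInL2 (A u) → SolvesCS A f ψ h u → SolvesVI A f ψ h u) ∧
      (SolvesVI A f ψ h u → IsContinuousOnClosure u → IsInL2 (A u) → IsContinuousOnClosure ψ →
        SolvesCS A f ψ h u) :=
    fun _ _ => ⟨fun _ hu => hu.solvesVI, fun hu huc hA hψc => hu.solvesCS hΩ huc hA hψc⟩
  exact ⟨key, fun b k u => key (ellipticOperator b k) u⟩
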